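/- **Conventions.** A represented space $\mathbf X$ is a set $X$ with a partial surjection $\delta_{\mathbf X}:\subseteq\mathbb N^{\mathbb N}\to X$; if $\delta_{\mathbf X}(p)=x$, then $p$ is a name of $x$. A map $f:\mathbf X\to\mathbf Y$ is computable if some computable partial function on $\mathbb N^{\mathbb N}$ sends every name of every $x\in X$ to a name of $f(x)$; a computable isomorphism is a computable bijection with computable inverse. A name of $(x,y)\in\mathbf X\times\mathbf Y$ is the interleaving of a name of $x$ and a name of $y$. The space $\mathbb N$ is represented by $p\mapsto p(0)$. Sierpinski space $\mathbb S=\{\top,\bot\}$ is represented by letting $0^\omega$ name $\bot$ and every other sequence name $\top$. A subset of $\mathbf X$ is computably open if its characteristic function $\mathbf X\to\mathbb S$ is computable, and computably closed if its complement is computably open. The space $\mathbf X$ is computably discrete if the diagonal of $\mathbf X\times\mathbf X$ is computably open, and computably Hausdorff if the diagonal is computably closed. For a transitive relation $\ll$ on $\mathbb N$, an ideal is a non-empty $I\subseteq\mathbb N$ that is downwards closed ($x\ll y\in I$ implies $x\in I$) and upwards directed (for $x,y\in I$ there is $z\in I$ with $x\ll z$ and $y\ll z$); the space of ideals $\mathbf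 I(\ll)$ is the set of ideals, where $p$ names $I$ if and only if $I=\{p(k)\mid k\in\mathbb N\}$. A space is precomputably Quasi-Polish if it is computably isomorphic to $\mathbf I(\ll)$ for some computably enumerable transitive relation $\ll$ on $\mathbb N$. The space $\mathcal O(\mathbb N)$ is the set of all subsets of $\mathbb N$, where $p$ names $\{n\mid\exists k\ p(k)=n+1\}$. Subspaces carry the restricted representation, and a name of $(n,x)\in\sum_{n\in\mathbb N}\mathbf X_n$ is $n$ followed by a name of $x$ in $\mathbf X_n$. **Statement.** There is a represented space $\mathbf X$ that is computably discrete, computably Hausdorff and precomputably Quasi-Polish, such that there is no computable injection $\mathbf X\to\mathbb N$. Moreover, $\mathbf X$ can be taken to be a sum $\sum_{n\in\mathbb N}\mathbf X_n$ of subspaces $\mathbf X_n\subseteq\mathcal O(\mathbb N)$ for which there are uniformly computably enumerable sequences $(A_n)_{n\in\mathbb N}$ and $(B_n)_{n\in\mathbb N}$ of subsets of $\mathbb N$ such that, for every $n$, either $\mathbf X_n=\{\mathbb N\}$, or $I_n:=A_n\setminus B_n$ is finite and $\mathbf X_n=\{I_n,\mathbb N\setminus I_n\}$. -/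

import Mathlib

/-- The first `k` values of a point of Baire space, as a finite word. -/
def initialWord (p : ℕ → ℕ) (k : ℕ) : List ℕ := (List.range k).map p

/-- Computability of a partial function on Baire space: it is generated by a computable function
`h` on finite words that is monotone for the prefix order. Here `h w` is the output written by the
machine after it has read the finite part `w` of the input, and the function is defined at `p`,
with value `q`, exactly if the output written on the prefixes of `p` grows to the infinite
sequence `q`. -/
def IsComputableFunctional (R : (ℕ → ℕ) →. (ℕ → ℕ)) : Prop :=
  ∃ h : List ℕ → List ℕ, Computable h ∧
    (∀ u v : List ℕ, u <+: v → h u <+: h v) ∧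
    ∀ p q : ℕ → ℕ, q ∈ R p ↔ ∀ k : ℕ, ∃ n : ℕ, initialWord q k <+: h (initialWord p n)

/-- A represented space: a set with a partial surjection from Baire space onto it. -/
structure RepresentedSpace where
  Carrier : Type
  rep : (ℕ → ℕ) →. Carrier
  rep_surjective : ∀ x : Carrier, ∃ p : ℕ → ℕ, x ∈ rep p

namespace RepresentedSpace

/-- `R` realises the total single-valued map `f`. -/
def Realises (X Y : RepresentedSpace) (R : (ℕ → ℕ) →. (ℕ → ℕ)) (f : X.Carrier → Y.Carrier) :
    Prop :=
  ∀ (p : ℕ → ℕ) (x : X.Carrier), x ∈ X.rep p → ∃ q : ℕ → ℕ, q ∈ R p ∧ f x ∈ Y.rep q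

/-- A map of represented spaces is computable if it has a computable realiser. -/
def IsComputableMap (X Y : RepresentedSpace) (f : X.Carrier → Y.Carrier) : Prop :=
  ∃ R : (ℕ → ℕ) →. (ℕ → ℕ), IsComputableFunctional R ∧ Realises X Y R f

/-- Computable isomorphism of represented spaces. -/
def ComputablyIsomorphic (X Y : RepresentedSpace) : Prop :=
  ∃ e : X.Carrier ≃ Y.Carrier, IsComputableMap X Y e ∧ IsComputableMap Y X e.symm

/-- The natural numbers; `p` is a name of `p 0`. -/
def natSpace : RepresentedSpace where
  Carrier := ℕ
  rep := fun p => Part.some (p 0)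
  rep_surjective := fun x => ⟨fun _ => x, Part.mem_some x⟩

/-- Sierpinski space: `⊤` is `True`, `⊥` is `False`; the zero sequence is the only name of `⊥`. -/
def sierpinski : RepresentedSpace where
  Carrier := Prop
  rep := fun p => Part.some (∃ k, p k ≠ 0)
  rep_surjective := fun b => by
    by_cases hb : b
    · exact ⟨fun _ => 1, by simp [hb]⟩
    · exact ⟨fun _ => 0, by simp [hb]⟩

/-- The product: even positions name the first component, odd positions the second one. -/
def prod (X Y : RepresentedSpace) : RepresentedSpace where
  Carrier := X.Carrier × Y.Carrier
  rep := fun p =>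
    (X.rep fun n => p (2 * n)).bind fun x => (Y.rep fun n => p (2 * n + 1)).map fun y => (x, y)
  rep_surjective := by
    rintro ⟨x, y⟩
    obtain ⟨p, hp⟩ := X.rep_surjective x
    obtain ⟨q, hq⟩ := Y.rep_surjective y
    refine ⟨fun n => if n % 2 = 0 then p (n / 2) else q (n / 2), ?_⟩
    have h1 : (fun n => (fun n => if n % 2 = 0 then p (n / 2) else q (n / 2)) (2 * n)) = p := by
      funext n; simp
    have h2 : (fun n => (fun n => if n % 2 = 0 then p (n / 2) else q (n / 2)) (2 * n + 1)) = q := by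
      funext n
      have e1 : (2 * n + 1) % 2 = 1 := by omega
      have e2 : (2 * n + 1) / 2 = n := by omega
      simp [e1, e2]
    rw [h1, h2]
    exact Part.mem_bind hp (Part.mem_map (fun y => (x, y)) hq)

/-- A subset is computably open if its characteristic function into Sierpinski space is
computable. -/
def IsComputablyOpen (X : RepresentedSpace) (U : Set X.Carrier) : Prop :=
  IsComputableMap X sierpinski fun x => x ∈ U

/-- A subset is computably closed if its complement is computably open. -/
def IsComputablyClosed (X : RepresentedSpace) (A : Set X.Carrier) : Prop :=
  IsComputablyOpen X Aᶜ

/-- Computable discreteness: the diagonal is computably open. -/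
def IsComputablyDiscrete (X : RepresentedSpace) : Prop :=
  IsComputablyOpen (X.prod X) {z : X.Carrier × X.Carrier | z.1 = z.2}

/-- Computable Hausdorffness: the diagonal is computably closed. -/
def IsComputablyHausdorff (X : RepresentedSpace) : Prop :=
  IsComputablyClosed (X.prod X) {z : X.Carrier × X.Carrier | z.1 = z.2}

/-- Ideals of a relation `r` on the natural numbers: non-empty, downwards closed and upwards
directed sets. -/
structure IsIdeal (r : ℕ → ℕ → Prop) (I : Set ℕ) : Prop where
  nonempty : I.Nonempty
  down : ∀ x y : ℕ, y ∈ I → r x y → x ∈ I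
  directed : ∀ x ∈ I, ∀ y ∈ I, ∃ z ∈ I, r x z ∧ r y z

/-- The space of ideals of `r`; `p` is a name of the ideal `I` if and only if `I` is the range
of `p`. -/
def idealSpace (r : ℕ → ℕ → Prop) : RepresentedSpace where
  Carrier := {I : Set ℕ // IsIdeal r I}
  rep := fun p => Part.assert (IsIdeal r (Set.range p)) fun h => Part.some ⟨Set.range p, h⟩
  rep_surjective := by
    rintro ⟨I, hI⟩
    obtain ⟨p, rfl⟩ := (Set.to_countable I).exists_eq_range hI.nonempty
    exact ⟨p, Part.mem_assert hI (Part.mem_some _)⟩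

/-- A space is precomputably Quasi-Polish if it is computably isomorphic to the space of ideals of
a computably enumerable transitive relation on the natural numbers. -/
def IsPrecomputablyQuasiPolish (X : RepresentedSpace) : Prop :=
  ∃ r : ℕ → ℕ → Prop, REPred (fun k : ℕ × ℕ => r k.1 k.2) ∧
    (∀ a b c : ℕ, r a b → r b c → r a c) ∧ ComputablyIsomorphic X (idealSpace r)

/-- The space of open subsets (that is, of all subsets) of the natural numbers: `p` is a name of
the set that it enumerates, where the value `n + 1` lists `n` and the value `0` lists nothing. -/
def opensNat : RepresentedSpace where
  Carrier := Set ℕ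
  rep := fun p => Part.some {n | ∃ k, p k = n + 1}
  rep_surjective := fun U => by
    classical
    refine ⟨fun k => if k ∈ U then k + 1 else 0, ?_⟩
    rw [Part.mem_some_iff]
    ext n
    constructor
    · intro hn
      exact ⟨n, if_pos hn⟩
    · rintro ⟨k, hk⟩
      beta_reduce at hk
      by_cases hU : k ∈ U
      · rw [if_pos hU] at hk
        obtain rfl : k = n := by omega
        exact hU
      · rw [if_neg hU] at hk
        omega

/-- The subspace of `X` on a subset `S`, with the restricted representation. -/
def subspace (X : RepresentedSpace) (S : Set X.Carrier) : RepresentedSpace where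
  Carrier := {x : X.Carrier // x ∈ S}
  rep := fun p => (X.rep p).bind fun x => Part.assert (x ∈ S) fun h => Part.some ⟨x, h⟩
  rep_surjective := by
    rintro ⟨x, hx⟩
    obtain ⟨p, hp⟩ := X.rep_surjective x
    exact ⟨p, Part.mem_bind hp (Part.mem_assert hx (Part.mem_some _))⟩

/-- The sum of a sequence of spaces: a name of `(n, x)` consists of `n` followed by a name
of `x`. -/
def sum (X : ℕ → RepresentedSpace) : RepresentedSpace where
  Carrier := Σ n : ℕ, (X n).Carrier
  rep := fun p => ((X (p 0)).rep fun k => p (k + 1)).map fun x => ⟨p 0, x⟩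
  rep_surjective := by
    rintro ⟨n, x⟩
    obtain ⟨p, hp⟩ := (X n).rep_surjective x
    let q : ℕ → ℕ := fun k => match k with
      | 0 => n
      | k + 1 => p k
    have hq : x ∈ (X (q 0)).rep fun k => q (k + 1) := hp
    exact ⟨q, Part.mem_map (fun y => (⟨q 0, y⟩ : Σ n : ℕ, (X n).Carrier)) hq⟩

end RepresentedSpace

/-! ### Primitive recursive predicates with bounded quantifiers -/

/-! The space is a sum of families `listPair (limitList n)`: the non-empty sets among a finite set
`I_n` and its complement. Each `I_n` is built against the `n`-th program alone. Run program `n` on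
the list `0, 1, 2, …` as a name of `(n, ℕ)`. If it never answers, `I_n` stays empty and it fails at
the only point `(n, ℕ)`. If it answers `m` after seeing `0, …, k - 1`, put `I_n = {k}` and run it on
`k, k, k, …`. No answer means failure at `(n, {k})`. The answer `m` again means that `{k}` and its
complement get the same value, since `0, …, k - 1` also begins a name of the complement. On a
different answer, enlarge `I_n` to `{0, …, k}`: both prefixes now begin names of this one set, so
the program is not single-valued. This is `not_exists_computable_injection`. Members of a family are
non-empty and pairwise disjoint, so equality is witnessed by a common element. Once `k`, the pivot,
is found, it remains the largest element of `I_n`, so two members differ exactly if one contains `k`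
and the other contains something larger (`ne_iff_exists_separates`). For the Quasi-Polish property,
membership in a family is a condition "for every finite part and every stage there is a later stage
that approves" (`mem_listPair_iff`). Tokens made of an index, a finite part and a stage turn this
condition into the ideals of a decidable transitive relation. -/

theorem PrimrecPred.exists_lt_bound {α : Type} [Primcodable α] {f : α → ℕ} {p : α → ℕ → Prop}
    (hf : Primrec f) (hp : PrimrecPred fun z : α × ℕ => p z.1 z.2) :
    PrimrecPred fun a => ∃ i < f a, p a i := by
  have h : PrimrecRel fun (i : ℕ) (a : α) => p a i :=
    PrimrecPred.comp hp (Primrec.snd.pair Primrec.fst)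
  exact ((PrimrecRel.exists_mem_list h).comp (Primrec.list_range.comp hf) Primrec.id).of_eq
    fun a => by simp

theorem PrimrecPred.forall_lt_bound {α : Type} [Primcodable α] {f : α → ℕ} {p : α → ℕ → Prop}
    (hf : Primrec f) (hp : PrimrecPred fun z : α × ℕ => p z.1 z.2) :
    PrimrecPred fun a => ∀ i < f a, p a i := by
  have h : PrimrecRel fun (i : ℕ) (a : α) => p a i :=
    PrimrecPred.comp hp (Primrec.snd.pair Primrec.fst)
  exact ((PrimrecRel.forall_mem_list h).comp (Primrec.list_range.comp hf) Primrec.id).of_eq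
    fun a => by simp

theorem PrimrecPred.exists_mem {α β : Type} [Primcodable α] [Primcodable β] {f : α → List β}
    {p : α → β → Prop} (hf : Primrec f) (hp : PrimrecPred fun z : α × β => p z.1 z.2) :
    PrimrecPred fun a => ∃ b ∈ f a, p a b := by
  have h : PrimrecRel fun (b : β) (a : α) => p a b :=
    PrimrecPred.comp hp (Primrec.snd.pair Primrec.fst)
  exact (PrimrecRel.exists_mem_list h).comp hf Primrec.id

theorem PrimrecPred.forall_mem {α β : Type} [Primcodable α] [Primcodable β] {f : α → List β}
    {p : α → β → Prop} (hf : Primrec f) (hp : PrimrecPred fun z : α × β => p z.1 z.2) :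
    PrimrecPred fun a => ∀ b ∈ f a, p a b := by
  have h : PrimrecRel fun (b : β) (a : α) => p a b :=
    PrimrecPred.comp hp (Primrec.snd.pair Primrec.fst)
  exact (PrimrecRel.forall_mem_list h).comp hf Primrec.id

theorem PrimrecPred.mem_list {α β : Type} [Primcodable α] [Primcodable β] {f : α → β}
    {g : α → List β} (hf : Primrec f) (hg : Primrec g) : PrimrecPred fun a => f a ∈ g a := by
  have h : PrimrecPred fun a => ∃ b ∈ g a, b = f a :=
    PrimrecPred.exists_mem (p := fun a b => b = f a) hg
      (Primrec.eq.comp Primrec.snd (hf.comp Primrec.fst))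
  exact h.of_eq fun a => by simp

/-- The projection of a primitive recursive predicate is computably enumerable. -/
theorem REPred.exists_of_primrecPred {α : Type} [Primcodable α] {p : α → ℕ → Prop}
    (hp : PrimrecPred fun z : α × ℕ => p z.1 z.2) : REPred fun a => ∃ t, p a t := by
  obtain ⟨d, hp⟩ := hp
  have : ∀ a t, Decidable (p a t) := fun a t => d (a, t)
  have h1 : Partrec₂ fun (a : α) (t : ℕ) =>
      (Part.some (decide (p a t)) : Part Bool) :=
    hp.to_comp.partrec.of_eq fun z => by
      exact congrArg Part.some (decide_eq_decide.2 Iff.rfl)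
  refine (Partrec.rfind h1).dom_re.of_eq fun a => ?_
  refine (Nat.rfind_dom (p := fun t => (Part.some (decide (p a t)) : Part Bool))).trans ?_
  simp

/-! ### Finite prefixes -/

@[simp]
theorem length_initialWord (p : ℕ → ℕ) (n : ℕ) : (initialWord p n).length = n := by
  simp [initialWord]

theorem getElem?_initialWord (p : ℕ → ℕ) (n i : ℕ) :
    (initialWord p n)[i]? = if i < n then some (p i) else none := by
  by_cases h : i < n <;> simp [initialWord, h]

theorem getD_initialWord (p : ℕ → ℕ) (n i : ℕ) :
    (initialWord p n).getD i 0 = if i < n then p i else 0 := by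
  rw [List.getD_eq_getElem?_getD, getElem?_initialWord]
  split_ifs <;> rfl

theorem take_initialWord (p : ℕ → ℕ) {i n : ℕ} (h : i ≤ n) :
    (initialWord p n).take i = initialWord p i := by
  simp [initialWord, ← List.map_take, List.take_range, h]

theorem initialWord_prefix (p : ℕ → ℕ) {i n : ℕ} (h : i ≤ n) :
    initialWord p i <+: initialWord p n := by
  rw [← take_initialWord p h]
  exact List.take_prefix _ _

theorem mem_tail_initialWord {p : ℕ → ℕ} {n a : ℕ} :
    a ∈ (initialWord p (n + 1)).tail ↔ ∃ i < n, p (i + 1) = a := by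
  simp [initialWord, List.range_succ_eq_map]

theorem eq_of_forall_initialWord_prefix {p q : ℕ → ℕ}
    (h : ∀ k, ∃ n, initialWord q k <+: initialWord p n) : q = p := by
  funext i
  obtain ⟨n, hn⟩ := h (i + 1)
  have h1 : (initialWord p n)[i]? = some (q i) := by
    obtain ⟨t, ht⟩ := hn
    rw [← ht, List.getElem?_append_left (by simp), getElem?_initialWord, if_pos i.lt_succ_self]
  rw [getElem?_initialWord] at h1
  split_ifs at h1
  exact (Option.some.inj h1).symm

/-- A primitive recursive function on words induces a total computable functional that writes one
symbol after each symbol that it reads. -/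
theorem isComputableFunctional_of_primrec {F : List ℕ → ℕ} (hF : Primrec F) :
    IsComputableFunctional fun p => Part.some fun i => F (initialWord p (i + 1)) := by
  have key : ∀ (p : ℕ → ℕ) (n : ℕ),
      (List.range (initialWord p n).length).map (fun i => F ((initialWord p n).take (i + 1))) =
        initialWord (fun i => F (initialWord p (i + 1))) n := by
    intro p n
    rw [length_initialWord]
    refine List.map_congr_left fun i hi => ?_
    rw [take_initialWord p (List.mem_range.1 hi)]
  refine ⟨fun w => (List.range w.length).map fun i => F (w.take (i + 1)), ?_, ?_, ?_⟩
  · exact (Primrec.list_map (Primrec.list_range.comp Primrec.list_length)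
      (hF.comp (Primrec.list_take.comp (Primrec.succ.comp Primrec.snd) Primrec.fst)).to₂).to_comp
  · intro u v huv
    obtain ⟨t, rfl⟩ := huv
    beta_reduce
    rw [List.length_append, List.range_add, List.map_append]
    refine ⟨_, congrArg (· ++ _) (List.map_congr_left fun i hi => ?_)⟩
    rw [List.take_append_of_le_length (List.mem_range.1 hi)]
  · intro p q
    simp only [key, Part.mem_some_iff]
    constructor
    · rintro rfl k
      exact ⟨k, List.prefix_rfl⟩
    · exact eq_of_forall_initialWord_prefix

/-- The set of natural numbers named by `p` as a point of the space of subsets of `ℕ`. -/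
def enumeratedSet (p : ℕ → ℕ) : Set ℕ := {n | ∃ k, p k = n + 1}

/-! ### Names and realisers; discrete and Hausdorff sums of families. -/

namespace RepresentedSpace

theorem isComputableMap_of_primrec {X Y : RepresentedSpace} {f : X.Carrier → Y.Carrier}
    {F : List ℕ → ℕ} (hF : Primrec F)
    (H : ∀ p x, x ∈ X.rep p → f x ∈ Y.rep fun i => F (initialWord p (i + 1))) :
    IsComputableMap X Y f :=
  ⟨_, isComputableFunctional_of_primrec hF, fun p x hx => ⟨_, Part.mem_some _, H p x hx⟩⟩

/-- A set is computably open if membership is witnessed by a primitive recursive property of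
finite prefixes of names. -/
theorem isComputablyOpen_of_primrecPred {X : RepresentedSpace} {U : Set X.Carrier}
    {P : List ℕ → Prop} (hP : PrimrecPred P)
    (H : ∀ p x, x ∈ X.rep p → (x ∈ U ↔ ∃ n, P (initialWord p (n + 1)))) :
    IsComputablyOpen X U := by
  obtain ⟨_, -⟩ := id hP
  refine isComputableMap_of_primrec (F := fun w => if P w then 1 else 0)
    (Primrec.ite hP (Primrec.const 1) (Primrec.const 0)) fun p x hx => ?_
  refine Part.mem_some_iff.2 (propext ((H p x hx).trans ?_))
  simp

theorem mem_rep_prod {X Y : RepresentedSpace} {p : ℕ → ℕ} {z : X.Carrier × Y.Carrier} :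
    z ∈ (X.prod Y).rep p ↔
      z.1 ∈ X.rep (fun n => p (2 * n)) ∧ z.2 ∈ Y.rep (fun n => p (2 * n + 1)) := by
  obtain ⟨x, y⟩ := z
  constructor
  · intro h
    obtain ⟨a, ha, h⟩ := Part.mem_bind_iff.1 h
    obtain ⟨b, hb, h⟩ := (Part.mem_map_iff _).1 h
    obtain ⟨rfl, rfl⟩ := Prod.mk.inj h
    exact ⟨ha, hb⟩
  · rintro ⟨ha, hb⟩
    exact Part.mem_bind ha (Part.mem_map (fun y => (x, y)) hb)

theorem mem_rep_natSpace {p : ℕ → ℕ} {n : ℕ} : n ∈ natSpace.rep p ↔ n = p 0 :=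
  Part.mem_some_iff

theorem mem_rep_idealSpace {r : ℕ → ℕ → Prop} {p : ℕ → ℕ} {I : {I : Set ℕ // IsIdeal r I}} :
    I ∈ (idealSpace r).rep p ↔ I.1 = Set.range p := by
  obtain ⟨I, hI⟩ := I
  constructor
  · intro h
    obtain ⟨_, h⟩ := Part.mem_assert_iff.1 h
    exact congrArg Subtype.val (Part.mem_some_iff.1 h)
  · rintro rfl
    exact Part.mem_assert hI (Part.mem_some _)

/-- The sum of the subspaces of the space of subsets of `ℕ` given by the families `S n`. -/
abbrev familySpace (S : ℕ → Set (Set ℕ)) : RepresentedSpace :=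
  sum fun n => opensNat.subspace (S n)

theorem mem_rep_familySpace {S : ℕ → Set (Set ℕ)} {p : ℕ → ℕ} {z : (familySpace S).Carrier} :
    z ∈ (familySpace S).rep p ↔
      z.1 = p 0 ∧ z.2.1 = enumeratedSet fun k => p (k + 1) := by
  obtain ⟨n, x, hx⟩ := z
  constructor
  · intro h
    obtain ⟨y, hy, h⟩ := (Part.mem_map_iff _).1 h
    obtain ⟨rfl, h⟩ := Sigma.mk.inj_iff.1 h
    obtain rfl := eq_of_heq h
    refine ⟨rfl, ?_⟩
    obtain ⟨a, ha, hy⟩ := Part.mem_bind_iff.1 hy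
    obtain ⟨_, h⟩ := Part.mem_assert_iff.1 hy
    exact (congrArg Subtype.val (Part.mem_some_iff.1 h)).trans (Part.mem_some_iff.1 ha)
  · rintro ⟨rfl, h⟩
    exact Part.mem_map (fun y => (⟨p 0, y⟩ : (familySpace S).Carrier))
      (Part.mem_bind (Part.mem_some_iff.2 h) (Part.mem_assert hx (Part.mem_some _)))

theorem familySpace_ext {S : ℕ → Set (Set ℕ)} {z z' : (familySpace S).Carrier}
    (h : z.1 = z'.1) (h' : z.2.1 = z'.2.1) : z = z' := by
  obtain ⟨n, x, hx⟩ := z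
  obtain ⟨n', x', hx'⟩ := z'
  obtain rfl : n = n' := h
  obtain rfl : x = x' := h'
  rfl

/-- Whenever the realiser of a map to `ℕ` writes a first symbol, it is the value of the map. -/
theorem head_eq_of_mem_rep {X : RepresentedSpace} {f : X.Carrier → ℕ} {R : (ℕ → ℕ) →. (ℕ → ℕ)}
    (hR : Realises X natSpace R f) {h : List ℕ → List ℕ}
    (hmono : ∀ u v : List ℕ, u <+: v → h u <+: h v)
    (hRh : ∀ p q : ℕ → ℕ, q ∈ R p ↔ ∀ k : ℕ, ∃ n : ℕ, initialWord q k <+: h (initialWord p n))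
    {p : ℕ → ℕ} {x : X.Carrier} (hx : x ∈ X.rep p) :
    (∃ N, ∀ n ≥ N, (h (initialWord p n)).head? = some (f x)) ∧
      ∀ n m, (h (initialWord p n)).head? = some m → m = f x := by
  obtain ⟨q, hq, hfx⟩ := hR p x hx
  have hfx : f x = q 0 := mem_rep_natSpace.1 hfx
  have head_mono : ∀ {u v : List ℕ} {a : ℕ}, u <+: v → u.head? = some a → v.head? = some a := by
    rintro u v a ⟨t, rfl⟩ hu
    simp [List.head?_append, hu]
  obtain ⟨N, hN⟩ := (hRh p q).1 hq 1
  have hN' : ∀ n ≥ N, (h (initialWord p n)).head? = some (f x) := fun n hn =>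
    head_mono (hN.trans (hmono _ _ (initialWord_prefix p hn))) (by simp [initialWord, hfx])
  refine ⟨⟨N, hN'⟩, fun n m hm => ?_⟩
  have h1 := head_mono (hmono _ _ (initialWord_prefix p (le_max_left n N))) hm
  rw [hN' _ (le_max_right n N)] at h1
  exact (Option.some.inj h1).symm

/-- A sum of families of sets is computably discrete if the members of each family are nonempty and
pairwise disjoint. -/
theorem isComputablyDiscrete_familySpace {S : ℕ → Set (Set ℕ)}
    (hS : ∀ n, ∀ x ∈ S n, ∀ y ∈ S n, x = y ↔ (x ∩ y).Nonempty) :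
    (familySpace S).IsComputablyDiscrete := by
  -- In an interleaved name, positions `0` and `1` hold the two indices, and the entries of the two
  -- sets stand at `2 * i + 2` and `2 * j + 3`. Excluding the value `0` rules out both empty
  -- listings and positions beyond the word, so the indices have been read as well.
  refine isComputablyOpen_of_primrecPred
    (P := fun w => w.getD 0 0 = w.getD 1 0 ∧ ∃ i < w.length, ∃ j < w.length,
      w.getD (2 * i + 2) 0 = w.getD (2 * j + 3) 0 ∧ w.getD (2 * i + 2) 0 ≠ 0) ?_ ?_
  · have hget := Primrec.list_getD (α := ℕ) 0
    refine (Primrec.eq.comp (hget.comp .id (.const 0)) (hget.comp .id (.const 1))).and ?_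
    refine PrimrecPred.exists_lt_bound .list_length (PrimrecPred.exists_lt_bound
      (Primrec.list_length.comp .fst) ?_)
    have hi : Primrec fun z : (List ℕ × ℕ) × ℕ => z.1.1.getD (2 * z.1.2 + 2) 0 :=
      hget.comp (Primrec.fst.comp .fst) (Primrec.nat_add.comp
        (Primrec.nat_mul.comp (.const 2) (Primrec.snd.comp .fst)) (.const 2))
    have hj : Primrec fun z : (List ℕ × ℕ) × ℕ => z.1.1.getD (2 * z.2 + 3) 0 :=
      hget.comp (Primrec.fst.comp .fst) (Primrec.nat_add.comp
        (Primrec.nat_mul.comp (.const 2) .snd) (.const 3))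
    exact (Primrec.eq.comp hi hj).and (Primrec.eq.comp hi (.const 0)).not
  · rintro p ⟨⟨n, x, hx⟩, ⟨n', y, hy⟩⟩ hz
    obtain ⟨hz1, hz2⟩ := mem_rep_prod.1 hz
    obtain ⟨h1, h1'⟩ : n = p 0 ∧ x = enumeratedSet fun k => p (2 * (k + 1)) :=
      mem_rep_familySpace.1 hz1
    obtain ⟨h2, h2'⟩ : n' = p 1 ∧ y = enumeratedSet fun k => p (2 * (k + 1) + 1) :=
      mem_rep_familySpace.1 hz2
    simp only [getD_initialWord, length_initialWord]
    constructor
    · intro h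
      obtain ⟨rfl, h⟩ := Sigma.mk.inj_iff.1 h
      have h : x = y := congrArg Subtype.val (eq_of_heq h)
      obtain ⟨a, hax, hay⟩ := (hS n x hx y hy).1 h
      rw [h1'] at hax
      rw [h2'] at hay
      obtain ⟨i, hi⟩ := hax
      obtain ⟨j, hj⟩ := hay
      refine ⟨2 * i + 2 * j + 3, ?_, i, by omega, j, by omega, ?_⟩
      · rw [if_pos (by omega), if_pos (by omega)]
        exact h1.symm.trans h2
      · rw [if_pos (by omega), if_pos (by omega)]
        simp only [mul_add, mul_one] at hi hj
        exact ⟨hi.trans hj.symm, by rw [hi]; omega⟩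
    · rintro ⟨N, h0, i, hi, j, hj, hij, hne⟩
      have hi' : 2 * i + 2 < N + 1 := by
        by_contra hc
        exact hne (if_neg hc)
      have hj' : 2 * j + 3 < N + 1 := by
        by_contra hc
        rw [if_neg hc] at hij
        exact hne hij
      rw [if_pos (by omega), if_pos (by omega)] at h0
      rw [if_pos hi', if_pos hj'] at hij
      rw [if_pos hi'] at hne
      obtain rfl : n = n' := h1.trans (h0.trans h2.symm)
      obtain ⟨a, ha⟩ := Nat.exists_eq_succ_of_ne_zero hne
      have : x = y := (hS n x hx y hy).2
        ⟨a, by rw [h1']; exact ⟨i, ha⟩, by rw [h2']; exact ⟨j, hij.symm.trans ha⟩⟩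
      subst this
      rfl

/-- A sum of families of sets is computably Hausdorff if two members of a family are different
exactly if they contain numbers `a` and `b` that are separated at some stage, for a primitive
recursive separation relation that grows with the stage. -/
theorem isComputablyHausdorff_familySpace {S : ℕ → Set (Set ℕ)} {D : ℕ → ℕ → ℕ → ℕ → Prop}
    (hD : PrimrecPred fun z : ((ℕ × ℕ) × ℕ) × ℕ => D z.1.1.1 z.1.1.2 z.1.2 z.2)
    (hmono : ∀ n t t' a b, t ≤ t' → D n t a b → D n t' a b)
    (hS : ∀ n, ∀ x ∈ S n, ∀ y ∈ S n, x ≠ y ↔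
      ∃ t, ∃ a ∈ x, ∃ b ∈ y, D n t a b) :
    (familySpace S).IsComputablyHausdorff := by
  -- The bound `2 ≤ w.length` is needed for different indices: on a word of length one, the default
  -- `0` would be taken for the second index. The length of the word doubles as the stage of the
  -- separation.
  refine isComputablyOpen_of_primrecPred
    (P := fun w => (2 ≤ w.length ∧ w.getD 0 0 ≠ w.getD 1 0) ∨
      ∃ i < w.length, ∃ j < w.length,
        (w.getD (2 * i + 2) 0 ≠ 0 ∧ w.getD (2 * j + 3) 0 ≠ 0) ∧
        D (w.getD 0 0) w.length (w.getD (2 * i + 2) 0 - 1) (w.getD (2 * j + 3) 0 - 1)) ?_ ?_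
  · have hget := Primrec.list_getD (α := ℕ) 0
    refine PrimrecPred.or ((Primrec.nat_le.comp (.const 2) .list_length).and
      (Primrec.eq.comp (hget.comp .id (.const 0)) (hget.comp .id (.const 1))).not) ?_
    refine PrimrecPred.exists_lt_bound .list_length (PrimrecPred.exists_lt_bound
      (Primrec.list_length.comp .fst) ?_)
    have hi : Primrec fun z : (List ℕ × ℕ) × ℕ => z.1.1.getD (2 * z.1.2 + 2) 0 :=
      hget.comp (Primrec.fst.comp .fst) (Primrec.nat_add.comp
        (Primrec.nat_mul.comp (.const 2) (Primrec.snd.comp .fst)) (.const 2))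
    have hj : Primrec fun z : (List ℕ × ℕ) × ℕ => z.1.1.getD (2 * z.2 + 3) 0 :=
      hget.comp (Primrec.fst.comp .fst) (Primrec.nat_add.comp
        (Primrec.nat_mul.comp (.const 2) .snd) (.const 3))
    have h0 : Primrec fun z : (List ℕ × ℕ) × ℕ => z.1.1.getD 0 0 :=
      hget.comp (Primrec.fst.comp .fst) (.const 0)
    exact ((Primrec.eq.comp hi (.const 0)).not.and (Primrec.eq.comp hj (.const 0)).not).and
      (PrimrecPred.comp hD (((h0.pair (Primrec.list_length.comp (Primrec.fst.comp .fst))).pair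
        (Primrec.pred.comp hi)).pair (Primrec.pred.comp hj)))
  · rintro p ⟨⟨n, x, hx⟩, ⟨n', y, hy⟩⟩ hz
    obtain ⟨hz1, hz2⟩ := mem_rep_prod.1 hz
    obtain ⟨h1, h1'⟩ : n = p 0 ∧ x = enumeratedSet fun k => p (2 * (k + 1)) :=
      mem_rep_familySpace.1 hz1
    obtain ⟨h2, h2'⟩ : n' = p 1 ∧ y = enumeratedSet fun k => p (2 * (k + 1) + 1) :=
      mem_rep_familySpace.1 hz2
    simp only [getD_initialWord, length_initialWord]
    constructor
    · intro h
      by_cases hn : n = n'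
      · subst hn
        have hxy : x ≠ y := by
          rintro rfl
          exact h rfl
        obtain ⟨t, a, hax, b, hby, hab⟩ := (hS n x hx y hy).1 hxy
        rw [h1'] at hax
        rw [h2'] at hby
        obtain ⟨i, hi⟩ := hax
        obtain ⟨j, hj⟩ := hby
        simp only [mul_add, mul_one] at hi hj
        -- The prefix covers both entries and is longer than `t`; `hmono` lifts the separation to
        -- that stage.
        refine ⟨2 * i + 2 * j + 3 + t, .inr ⟨i, by omega, j, by omega, ?_⟩⟩
        rw [if_pos (by omega), if_pos (by omega), if_pos (by omega), hi, hj]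
        refine ⟨⟨by omega, by omega⟩, ?_⟩
        rw [← h1]
        exact hmono _ _ _ _ _ (by omega) hab
      · refine ⟨1, .inl ⟨le_rfl, ?_⟩⟩
        rw [if_pos (by omega), if_pos (by omega)]
        exact fun h => hn (h1.trans (h.trans h2.symm))
    · rintro ⟨N, ⟨hN, h0⟩ | ⟨i, hi, j, hj, ⟨hi', hj'⟩, hab⟩⟩ h
      · obtain ⟨rfl, -⟩ := Sigma.mk.inj_iff.1 h
        rw [if_pos (by omega), if_pos (by omega)] at h0
        exact h0 (h1.symm.trans h2)
      · obtain ⟨rfl, h⟩ := Sigma.mk.inj_iff.1 h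
        have h : x = y := congrArg Subtype.val (eq_of_heq h)
        have hi1 : 2 * i + 2 < N + 1 := by
          by_contra hc
          exact hi' (if_neg hc)
        have hj1 : 2 * j + 3 < N + 1 := by
          by_contra hc
          exact hj' (if_neg hc)
        rw [if_pos hi1] at hi' hab
        rw [if_pos hj1] at hj' hab
        rw [if_pos (by omega)] at hab
        rw [← h1] at hab
        refine (hS n x hx y hy).2 ⟨_, _, ?_, _, ?_, hab⟩ h
        · rw [h1']
          exact ⟨i, by simp only [mul_add, mul_one]; omega⟩
        · rw [h2']
          exact ⟨j, (Nat.sub_add_cancel (Nat.pos_of_ne_zero hj')).symm⟩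

end RepresentedSpace

/-! ### Families of sets given by approximations -/

/-- The list of natural numbers coded by `c`. -/
def codedList (c : ℕ) : List ℕ := (Encodable.decode (α := List ℕ) c).getD []

@[simp]
theorem codedList_encode (l : List ℕ) : codedList (Encodable.encode l) = l := by
  simp [codedList]

theorem primrec_codedList : Primrec codedList :=
  Primrec.option_getD.comp Primrec.decode (Primrec.const [])

/-- A token `k` consists of an index, a finite list of elements and a stage. -/
def tokenIndex (k : ℕ) : ℕ := k.unpair.1

/-- The finite list of elements of a token. -/
def tokenList (k : ℕ) : List ℕ := codedList k.unpair.2.unpair.1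

/-- The stage of a token. -/
def tokenStage (k : ℕ) : ℕ := k.unpair.2.unpair.2

/-- The token with the given index, list of elements and stage. -/
def token (n : ℕ) (G : List ℕ) (s : ℕ) : ℕ := Nat.pair n (Nat.pair (Encodable.encode G) s)

@[simp]
theorem tokenIndex_token (n G s) : tokenIndex (token n G s) = n := by
  simp [tokenIndex, token]

@[simp]
theorem tokenList_token (n G s) : tokenList (token n G s) = G := by
  simp [tokenList, token]

@[simp]
theorem tokenStage_token (n G s) : tokenStage (token n G s) = s := by
  simp [tokenStage, token]

theorem primrec_tokenIndex : Primrec tokenIndex := Primrec.fst.comp Primrec.unpair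

theorem primrec_tokenList : Primrec tokenList :=
  primrec_codedList.comp (Primrec.fst.comp (Primrec.unpair.comp (Primrec.snd.comp Primrec.unpair)))

theorem primrec_tokenStage : Primrec tokenStage :=
  Primrec.snd.comp (Primrec.unpair.comp (Primrec.snd.comp Primrec.unpair))

/-- Relative to the approximation `I`, a set that contains `G` is found to contain `G'`: it
contains all of `I`, or avoids `I` and contains all numbers below `s` outside of `I`. -/
def Approves (I G : List ℕ) (s : ℕ) (G' : List ℕ) : Prop :=
  (I ≠ [] ∧ (∀ a ∈ G, a ∈ I) ∧ ∀ a ∈ I, a ∈ G') ∨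
    ((∀ a ∈ G, a ∉ I) ∧ ∀ j < s, j ∈ I ∨ j ∈ G')

theorem Approves.mono {I G₁ G G' G₁' : List ℕ} {s₁ s : ℕ} (h : Approves I G s G')
    (hG : ∀ a ∈ G₁, a ∈ G) (hs : s₁ ≤ s) (hG' : ∀ a ∈ G', a ∈ G₁') : Approves I G₁ s₁ G₁' := by
  rcases h with ⟨h1, h2, h3⟩ | ⟨h1, h2⟩
  · exact .inl ⟨h1, fun a ha => h2 a (hG a ha), fun a ha => hG' a (h3 a ha)⟩
  · exact .inr ⟨fun a ha => h1 a (hG a ha), fun j hj =>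
      (h2 j (hj.trans_le hs)).imp_right (hG' j)⟩

/-- The relation on tokens whose ideals are the sets described by the approximations `σ`. -/
def tokenRel (σ : ℕ → ℕ → List ℕ) (k k' : ℕ) : Prop :=
  tokenIndex k = tokenIndex k' ∧ tokenStage k < tokenStage k' ∧
    (∀ a ∈ tokenList k, a ∈ tokenList k') ∧
    ∃ t < tokenStage k' + 1, tokenStage k ≤ t ∧
      Approves (σ (tokenIndex k) t) (tokenList k) (tokenStage k) (tokenList k')

/-- The approval of the first step suffices: its stage stays below the last stage, and its
conclusion survives the passage to a larger list. -/
theorem tokenRel_trans {σ : ℕ → ℕ → List ℕ} {a b c : ℕ} (h : tokenRel σ a b)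
    (h' : tokenRel σ b c) : tokenRel σ a c := by
  obtain ⟨h1, h2, h3, t, ht, hst, hA⟩ := h
  obtain ⟨h1', h2', h3', -⟩ := h'
  exact ⟨h1.trans h1', h2.trans h2', fun x hx => h3' x (h3 x hx), t, by omega, hst,
    hA.mono (fun _ hx => hx) le_rfl h3'⟩

theorem primrecPred_approves {α : Type} [Primcodable α] {I G G' : α → List ℕ} {s : α → ℕ}
    (hI : Primrec I) (hG : Primrec G) (hs : Primrec s) (hG' : Primrec G') :
    PrimrecPred fun a => Approves (I a) (G a) (s a) (G' a) := by
  have hmem : ∀ {L : α → List ℕ}, Primrec L → PrimrecPred fun z : α × ℕ => z.2 ∈ L z.1 :=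
    fun hL => PrimrecPred.mem_list Primrec.snd (hL.comp Primrec.fst)
  refine PrimrecPred.or (PrimrecPred.and (Primrec.eq.comp hI (.const [])).not
    (PrimrecPred.and (PrimrecPred.forall_mem hG (hmem hI))
      (PrimrecPred.forall_mem hI (hmem hG')))) ?_
  exact PrimrecPred.and (PrimrecPred.forall_mem hG (hmem hI).not)
    (PrimrecPred.forall_lt_bound hs ((hmem hI).or (hmem hG')))

theorem primrecPred_tokenRel {σ : ℕ → ℕ → List ℕ} (hσ : Primrec₂ σ) :
    PrimrecPred fun k : ℕ × ℕ => tokenRel σ k.1 k.2 := by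
  refine PrimrecPred.and (Primrec.eq.comp (primrec_tokenIndex.comp .fst)
    (primrec_tokenIndex.comp .snd)) (PrimrecPred.and (Primrec.nat_lt.comp
      (primrec_tokenStage.comp .fst) (primrec_tokenStage.comp .snd)) (PrimrecPred.and ?_ ?_))
  · exact PrimrecPred.forall_mem (primrec_tokenList.comp .fst)
      (PrimrecPred.mem_list .snd (primrec_tokenList.comp (Primrec.snd.comp .fst)))
  · refine PrimrecPred.exists_lt_bound (Primrec.succ.comp (primrec_tokenStage.comp .snd))
      (PrimrecPred.and (Primrec.nat_le.comp
        (primrec_tokenStage.comp (Primrec.fst.comp .fst)) .snd) ?_)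
    exact primrecPred_approves (hσ.comp (primrec_tokenIndex.comp (Primrec.fst.comp .fst)) .snd)
      (primrec_tokenList.comp (Primrec.fst.comp .fst))
      (primrec_tokenStage.comp (Primrec.fst.comp .fst))
      (primrec_tokenList.comp (Primrec.snd.comp .fst))

/-- The nonempty sets among the set of elements of the list `I` and its complement. -/
def listPair (I : List ℕ) : Set (Set ℕ) :=
  {x | x.Nonempty ∧ (x = {j | j ∈ I} ∨ x = {j | j ∉ I})}

/-- Approval at arbitrarily late stages amounts to approval by the limit `I`. Approval of `[a, b]`
then puts `a` and `b` on the same side of `I`, and approval of `[a]` forces the rest of that side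
into `x`. The clause `I ≠ []` in `Approves` keeps the empty set out when `I` is empty. -/
theorem mem_listPair_iff {σ : ℕ → List ℕ} {I : List ℕ} (hI : ∃ T, ∀ t ≥ T, σ t = I)
    {x : Set ℕ} :
    x ∈ listPair I ↔ ∀ (G : List ℕ) (s : ℕ), (∀ a ∈ G, a ∈ x) →
      ∃ G' : List ℕ, (∀ a ∈ G', a ∈ x) ∧ ∃ t ≥ s, Approves (σ t) G s G' := by
  obtain ⟨T, hT⟩ := hI
  constructor
  · rintro ⟨⟨a, ha⟩, rfl | rfl⟩ G s hG
    · refine ⟨I, fun _ h => h, max s T, le_max_left _ _, ?_⟩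
      rw [hT _ (le_max_right _ _)]
      exact .inl ⟨List.ne_nil_of_mem ha, hG, fun _ h => h⟩
    · refine ⟨(List.range s).filter (· ∉ I), fun a ha => ?_, max s T, le_max_left _ _, ?_⟩
      · simpa using (List.mem_filter.1 ha).2
      · rw [hT _ (le_max_right _ _)]
        refine .inr ⟨hG, fun j hj => ?_⟩
        by_cases h : j ∈ I
        · exact .inl h
        · exact .inr (List.mem_filter.2 ⟨List.mem_range.2 hj, by simpa using h⟩)
  · intro h
    have h' : ∀ (G : List ℕ) (s : ℕ), (∀ a ∈ G, a ∈ x) →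
        ∃ G' : List ℕ, (∀ a ∈ G', a ∈ x) ∧ Approves I G s G' := by
      intro G s hG
      obtain ⟨G', hG', t, ht, hA⟩ := h G (max s T) hG
      rw [hT t (le_of_max_le_right ht)] at hA
      exact ⟨G', hG', hA.mono (fun _ h => h) (le_max_left _ _) fun _ h => h⟩
    have hne : x.Nonempty := by
      -- Testing the empty list at stage `j + 1` yields an element of `I` in the first alternative
      -- and `j` itself in the second.
      obtain ⟨j, hj⟩ := Infinite.exists_notMem_finset I.toFinset
      rw [List.mem_toFinset] at hj
      obtain ⟨G', hG', ⟨hI, -, hA⟩ | ⟨-, hA⟩⟩ := h' [] (j + 1) (by simp)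
      · obtain ⟨a, ha⟩ := List.exists_mem_of_ne_nil I hI
        exact ⟨a, hG' a (hA a ha)⟩
      · exact ⟨j, hG' j ((hA j j.lt_succ_self).resolve_left hj)⟩
    obtain ⟨a, ha⟩ := hne
    refine ⟨⟨a, ha⟩, ?_⟩
    by_cases haI : a ∈ I
    · refine .inl (Set.ext fun b => ⟨fun hb => ?_, fun hb => ?_⟩)
      · obtain ⟨G', -, ⟨-, hA, -⟩ | ⟨hA, -⟩⟩ := h' [a, b] 0 (by simp [ha, hb])
        · exact hA b (by simp)
        · exact absurd haI (hA a (by simp))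
      · obtain ⟨G', hG', ⟨-, -, hA⟩ | ⟨hA, -⟩⟩ := h' [a] 0 (by simp [ha])
        · exact hG' b (hA b hb)
        · exact absurd haI (hA a (by simp))
    · refine .inr (Set.ext fun b => ⟨fun hb => ?_, fun hb => ?_⟩)
      · obtain ⟨G', -, ⟨-, hA, -⟩ | ⟨hA, -⟩⟩ := h' [a, b] 0 (by simp [ha, hb])
        · exact absurd (hA a (by simp)) haI
        · exact hA b (by simp)
      · obtain ⟨G', hG', ⟨-, hA, -⟩ | ⟨-, hA⟩⟩ := h' [a] (b + 1) (by simp [ha])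
        · exact absurd (hA a (by simp)) haI
        · exact hG' b ((hA b b.lt_succ_self).resolve_left hb)

/-- The tokens that are correct for the point `(n, x)`. -/
def correctTokens (n : ℕ) (x : Set ℕ) : Set ℕ :=
  {k | tokenIndex k = n ∧ ∀ a ∈ tokenList k, a ∈ x}

-- Directedness is where the condition on `x` enters: one approval of the joined lists, at a stage
-- beyond both tokens, serves each of them by `Approves.mono`.
open RepresentedSpace in
theorem isIdeal_correctTokens {σ : ℕ → ℕ → List ℕ} {n : ℕ} {x : Set ℕ}
    (hx : ∀ (G : List ℕ) (s : ℕ), (∀ a ∈ G, a ∈ x) →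
      ∃ G' : List ℕ, (∀ a ∈ G', a ∈ x) ∧ ∃ t ≥ s, Approves (σ n t) G s G') :
    IsIdeal (tokenRel σ) (correctTokens n x) := by
  refine ⟨⟨token n [] 0, by simp [correctTokens]⟩, ?_, ?_⟩
  · rintro k k' ⟨h1, h2⟩ ⟨h3, -, h4, -⟩
    exact ⟨h3.trans h1, fun a ha => h2 a (h4 a ha)⟩
  · rintro k ⟨rfl, h2⟩ k' ⟨h1', h2'⟩
    obtain ⟨G', hG', t, ht, hA⟩ := hx (tokenList k ++ tokenList k')
      (max (tokenStage k) (tokenStage k')) fun a ha => (List.mem_append.1 ha).elim (h2 a) (h2' a)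
    have h3 := (le_max_left _ _).trans ht
    have h3' := (le_max_right _ _).trans ht
    refine ⟨token (tokenIndex k) (tokenList k ++ tokenList k' ++ G') (t + 1), ?_, ?_, ?_⟩
    · refine ⟨by simp, fun a ha => ?_⟩
      simp only [tokenList_token, List.mem_append] at ha
      rcases ha with (ha | ha) | ha
      exacts [h2 a ha, h2' a ha, hG' a ha]
    · refine ⟨by simp, by simp; omega, fun a ha => by simp [ha], t, by simp, h3, ?_⟩
      exact hA.mono (fun a ha => by simp [ha]) (le_max_left _ _) fun a ha => by simp [ha]
    · refine ⟨by simp [h1'], by simp; omega, fun a ha => by simp [ha], t, by simp, h3', ?_⟩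
      rw [h1']
      exact hA.mono (fun a ha => by simp [ha]) (le_max_right _ _) fun a ha => by simp [ha]

-- Directedness gives all tokens of `J` the same index; `x` is the union of their lists. The strict
-- growth of stages makes them unbounded in `J`, which forces approvals at arbitrarily late stages.
open RepresentedSpace in
theorem exists_eq_correctTokens {σ : ℕ → ℕ → List ℕ} {J : Set ℕ} (hJ : IsIdeal (tokenRel σ) J) :
    ∃ (n : ℕ) (x : Set ℕ), J = correctTokens n x ∧
      ∀ (G : List ℕ) (s : ℕ), (∀ a ∈ G, a ∈ x) →
        ∃ G' : List ℕ, (∀ a ∈ G', a ∈ x) ∧ ∃ t ≥ s, Approves (σ n t) G s G' := by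
  obtain ⟨k₀, hk₀⟩ := hJ.nonempty
  have hindex : ∀ k ∈ J, tokenIndex k = tokenIndex k₀ := by
    intro k hk
    obtain ⟨z, -, h1, h2⟩ := hJ.directed k hk k₀ hk₀
    exact h1.1.trans h2.1.symm
  have hstage : ∀ s, ∃ k ∈ J, s ≤ tokenStage k := by
    intro s
    induction s with
    | zero => exact ⟨k₀, hk₀, Nat.zero_le _⟩
    | succ s ih =>
      obtain ⟨k, hk, hs⟩ := ih
      obtain ⟨z, hz, h1, -⟩ := hJ.directed k hk k hk
      exact ⟨z, hz, hs.trans_lt h1.2.1⟩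
  let x : Set ℕ := {a | ∃ k ∈ J, a ∈ tokenList k}
  have hcover : ∀ (G : List ℕ) (s : ℕ), (∀ a ∈ G, a ∈ x) →
      ∃ k ∈ J, s ≤ tokenStage k ∧ ∀ a ∈ G, a ∈ tokenList k := by
    intro G s hG
    induction G with
    | nil =>
      obtain ⟨k, hk, hs⟩ := hstage s
      exact ⟨k, hk, hs, by simp⟩
    | cons b G ih =>
      obtain ⟨k, hk, hs, hkG⟩ := ih fun a ha => hG a (List.mem_cons_of_mem _ ha)
      obtain ⟨k', hk', hb⟩ := hG b List.mem_cons_self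
      obtain ⟨z, hz, h1, h2⟩ := hJ.directed k hk k' hk'
      refine ⟨z, hz, hs.trans h1.2.1.le, fun a ha => ?_⟩
      rcases List.mem_cons.1 ha with rfl | ha
      · exact h2.2.2.1 _ hb
      · exact h1.2.2.1 _ (hkG a ha)
  -- Some `k ∈ J` dominates `G` and `s`; its own approval, weakened to `G` and `s`, puts the token
  -- below an element of `J`. Downward closure then brings every correct token into `J`.
  have hmain : ∀ (G : List ℕ) (s : ℕ), (∀ a ∈ G, a ∈ x) →
      ∃ z ∈ J, tokenRel σ (token (tokenIndex k₀) G s) z := by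
    intro G s hG
    obtain ⟨k, hk, hs, hkG⟩ := hcover G s hG
    obtain ⟨z, hz, ⟨h1, h2, h3, t, ht, hst, hA⟩, -⟩ := hJ.directed k hk k hk
    rw [hindex k hk] at hA
    refine ⟨z, hz, ?_⟩
    simp only [tokenRel, tokenIndex_token, tokenList_token, tokenStage_token]
    exact ⟨(hindex z hz).symm, hs.trans_lt h2, fun a ha => h3 a (hkG a ha), t, ht, hs.trans hst,
      hA.mono hkG hs fun _ h => h⟩
  refine ⟨tokenIndex k₀, x, ?_, ?_⟩
  · ext k
    constructor
    · exact fun hk => ⟨hindex k hk, fun a ha => ⟨k, hk, ha⟩⟩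
    · rintro ⟨h1, h2⟩
      obtain ⟨z, hz, h⟩ := hmain (tokenList k) (tokenStage k) h2
      refine hJ.down k z hz ?_
      simpa only [tokenRel, tokenIndex_token, tokenList_token, tokenStage_token, h1] using h
  · intro G s hG
    obtain ⟨z, hz, h⟩ := hmain G s hG
    simp only [tokenRel, tokenIndex_token, tokenList_token, tokenStage_token] at h
    obtain ⟨-, -, -, t, -, hst, hA⟩ := h
    exact ⟨tokenList z, fun a ha => ⟨z, hz, ha⟩, t, hst, hA⟩

theorem correctTokens_injective {n n' : ℕ} {x x' : Set ℕ}
    (h : correctTokens n x = correctTokens n' x') : n = n' ∧ x = x' := by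
  have h0 : token n [] 0 ∈ correctTokens n' x' := h ▸ ⟨by simp, by simp⟩
  obtain rfl : n = n' := by simpa using h0.1
  refine ⟨rfl, Set.ext fun a => ?_⟩
  have ha : ∀ y : Set ℕ, token n [a] 0 ∈ correctTokens n y ↔ a ∈ y := by
    simp [correctTokens]
  rw [← ha, h, ha]

theorem exists_bound_of_forall_mem_enumeratedSet {q : ℕ → ℕ} {G : List ℕ}
    (hG : ∀ a ∈ G, a ∈ enumeratedSet q) : ∃ N, ∀ a ∈ G, ∃ i < N, q i = a + 1 := by
  induction G with
  | nil => exact ⟨0, by simp⟩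
  | cons b G ih =>
    obtain ⟨N, hN⟩ := ih fun a ha => hG a (List.mem_cons_of_mem _ ha)
    obtain ⟨i, hi⟩ := hG b List.mem_cons_self
    refine ⟨max N (i + 1), fun a ha => ?_⟩
    rcases List.mem_cons.1 ha with rfl | ha
    · exact ⟨i, lt_max_of_lt_right i.lt_succ_self, hi⟩
    · obtain ⟨j, hj, hj'⟩ := hN a ha
      exact ⟨j, lt_max_of_lt_left hj, hj'⟩

/-! ### The computable isomorphism with the space of ideals. -/

namespace RepresentedSpace

/-- The ideal of tokens of a point of a family given by approximations. -/
def idealOfPoint {σ : ℕ → ℕ → List ℕ} {I : ℕ → List ℕ} (hI : ∀ n, ∃ T, ∀ t ≥ T, σ n t = I n)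
    (z : (familySpace fun n => listPair (I n)).Carrier) : (idealSpace (tokenRel σ)).Carrier :=
  ⟨correctTokens z.1 z.2.1, isIdeal_correctTokens ((mem_listPair_iff (hI z.1)).1 z.2.2)⟩

theorem bijective_idealOfPoint {σ : ℕ → ℕ → List ℕ} {I : ℕ → List ℕ}
    (hI : ∀ n, ∃ T, ∀ t ≥ T, σ n t = I n) : Function.Bijective (idealOfPoint hI) := by
  constructor
  · intro z z' h
    obtain ⟨h1, h2⟩ := correctTokens_injective (congrArg Subtype.val h)
    exact familySpace_ext h1 h2
  · rintro ⟨J, hJ⟩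
    obtain ⟨n, x, rfl, hx⟩ := exists_eq_correctTokens hJ
    exact ⟨⟨n, x, (mem_listPair_iff (hI n)).2 hx⟩, rfl⟩

theorem isComputableMap_idealOfPoint {σ : ℕ → ℕ → List ℕ} {I : ℕ → List ℕ}
    (hI : ∀ n, ∃ T, ∀ t ≥ T, σ n t = I n) :
    IsComputableMap (familySpace fun n => listPair (I n)) (idealSpace (tokenRel σ))
      (idealOfPoint hI) := by
  -- Output position `i` tries the token with index `n` and remaining data `i.unpair.1`, accepting
  -- it if all its elements have been listed. Each candidate recurs at arbitrarily late positions,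
  -- so no correct token is missed. A rejected one is replaced by `token n [] 0`, which is always
  -- correct.
  let c : List ℕ → ℕ := fun w => (w.length - 1).unpair.1
  have hc : Primrec c := Primrec.fst.comp (Primrec.unpair.comp (Primrec.pred.comp .list_length))
  let k : List ℕ → ℕ := fun w => Nat.pair (w.getD 0 0) (c w)
  have hw : Primrec fun w : List ℕ => w.getD 0 0 := (Primrec.list_getD 0).comp .id (.const 0)
  have hk : Primrec k := Primrec₂.natPair.comp hw hc
  have hP : PrimrecPred fun w : List ℕ => ∀ a ∈ tokenList (k w), a + 1 ∈ w.tail :=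
    PrimrecPred.forall_mem (primrec_tokenList.comp hk)
      (PrimrecPred.mem_list (Primrec.succ.comp .snd) (Primrec.list_tail.comp .fst))
  obtain ⟨_, -⟩ := id hP
  refine isComputableMap_of_primrec
    (F := fun w => if ∀ a ∈ tokenList (k w), a + 1 ∈ w.tail then k w else token (w.getD 0 0) [] 0)
    (Primrec.ite hP hk (Primrec₂.natPair.comp hw (.const _))) fun p z hz => ?_
  obtain ⟨h1, h2⟩ := mem_rep_familySpace.1 hz
  refine mem_rep_idealSpace.2 (Set.ext fun m => ?_)
  have hget : ∀ i, (initialWord p (i + 1)).getD 0 0 = z.1 := by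
    intro i
    rw [getD_initialWord, if_pos i.succ_pos, h1]
  have hki : ∀ i, k (initialWord p (i + 1)) = Nat.pair z.1 i.unpair.1 := by
    intro i
    simp only [k, c, hget, length_initialWord, Nat.add_sub_cancel]
  simp only [hget, hki, Set.mem_range]
  constructor
  · rintro ⟨hm1, hm2⟩
    rw [h2] at hm2
    obtain ⟨N, hN⟩ := exists_bound_of_forall_mem_enumeratedSet hm2
    have hm : Nat.pair z.1 (Nat.pair m.unpair.2 N).unpair.1 = m := by
      rw [← hm1, Nat.unpair_pair]
      exact Nat.pair_unpair m
    refine ⟨Nat.pair m.unpair.2 N, ?_⟩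
    rw [hm, if_pos]
    intro a ha
    obtain ⟨i, hi, hpi⟩ := hN a ha
    exact mem_tail_initialWord.2 ⟨i, hi.trans_le (Nat.right_le_pair _ _), hpi⟩
  · rintro ⟨i, rfl⟩
    split_ifs with h
    · refine ⟨by simp [tokenIndex], fun a ha => ?_⟩
      obtain ⟨j, -, hj⟩ := mem_tail_initialWord.1 (h a ha)
      rw [h2]
      exact ⟨j, hj⟩
    · exact ⟨by simp, by simp⟩

theorem isComputableMap_of_idealOfPoint {σ : ℕ → ℕ → List ℕ} {I : ℕ → List ℕ}
    (hI : ∀ n, ∃ T, ∀ t ≥ T, σ n t = I n)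
    {g : (idealSpace (tokenRel σ)).Carrier → (familySpace fun n => listPair (I n)).Carrier}
    (hg : Function.RightInverse g (idealOfPoint hI)) :
    IsComputableMap (idealSpace (tokenRel σ)) (familySpace fun n => listPair (I n)) g := by
  -- Position `0` of the output is the index, so position `k + 1` is written after `k + 2` symbols
  -- and lists the entry `k.unpair.2` of the token `p k.unpair.1`. The default `0` lists nothing.
  let c : List ℕ → ℕ × ℕ := fun w => (w.length - 2).unpair
  have hc : Primrec c := Primrec.unpair.comp (Primrec.nat_sub.comp .list_length (.const 2))
  let e : List ℕ → ℕ := fun w =>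
    ((tokenList (w.getD (c w).1 0)).map Nat.succ).getD (c w).2 0
  have hget := Primrec.list_getD (α := ℕ) 0
  have he : Primrec e := hget.comp (Primrec.list_map (primrec_tokenList.comp
    (hget.comp .id (Primrec.fst.comp hc))) (Primrec.succ.comp .snd).to₂) (Primrec.snd.comp hc)
  refine isComputableMap_of_primrec
    (F := fun w => if w.length ≤ 1 then tokenIndex (w.getD 0 0) else e w)
    (Primrec.ite (Primrec.nat_le.comp .list_length (.const 1))
      (primrec_tokenIndex.comp (hget.comp .id (.const 0))) he) fun p J hJ => ?_
  have hJ : correctTokens (g J).1 (g J).2.1 = Set.range p :=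
    (congrArg Subtype.val (hg J)).trans (mem_rep_idealSpace.1 hJ)
  refine mem_rep_familySpace.2 ⟨?_, ?_⟩
  · have h0 : p 0 ∈ correctTokens (g J).1 (g J).2.1 := hJ ▸ Set.mem_range_self 0
    have h1 : (initialWord p (0 + 1)).getD 0 0 = p 0 := by
      rw [getD_initialWord, if_pos Nat.one_pos]
    simp only [h1, length_initialWord, zero_add, le_refl, if_true]
    exact h0.1.symm
  · have hek : ∀ k, e (initialWord p (k + 1 + 1)) =
        ((tokenList (p k.unpair.1)).map Nat.succ).getD k.unpair.2 0 := by
      intro k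
      have : c (initialWord p (k + 1 + 1)) = k.unpair := by simp [c]
      simp only [e, this, getD_initialWord]
      rw [if_pos (by have := Nat.unpair_left_le k; omega)]
    refine Set.ext fun a => ?_
    simp only [length_initialWord, hek, enumeratedSet]
    constructor
    · intro ha
      have h1 : token (g J).1 [a] 0 ∈ Set.range p := hJ ▸ ⟨by simp, by simpa using ha⟩
      obtain ⟨i, hi⟩ := h1
      refine ⟨Nat.pair i 0, ?_⟩
      rw [if_neg (by omega)]
      simp [hi]
    · rintro ⟨k, hk⟩
      rw [if_neg (by omega)] at hk
      have h1 : p k.unpair.1 ∈ correctTokens (g J).1 (g J).2.1 := hJ ▸ Set.mem_range_self _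
      refine h1.2 a ?_
      rw [List.getD_eq_getElem?_getD, List.getElem?_map] at hk
      cases h : (tokenList (p k.unpair.1))[k.unpair.2]? with
      | none => simp [h] at hk
      | some b =>
        obtain rfl : b = a := by simpa [h] using hk
        exact List.mem_of_getElem? h

/-- A family of pairs of a finite set and its complement that is given by a primitive recursive
eventually constant approximation is precomputably Quasi-Polish. -/
theorem isPrecomputablyQuasiPolish_familySpace {σ : ℕ → ℕ → List ℕ} (hσ : Primrec₂ σ)
    {I : ℕ → List ℕ} (hI : ∀ n, ∃ T, ∀ t ≥ T, σ n t = I n) :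
    (familySpace fun n => listPair (I n)).IsPrecomputablyQuasiPolish :=
  ⟨tokenRel σ,
    (primrecPred_tokenRel hσ).computablePred.to_re,
    fun _ _ _ => tokenRel_trans, Equiv.ofBijective _ (bijective_idealOfPoint hI),
    isComputableMap_idealOfPoint hI,
    isComputableMap_of_idealOfPoint hI (Equiv.ofBijective_apply_symm_apply _ _)⟩

end RepresentedSpace

/-! ### Diagonalisation -/

/-- The first value found by `f` before stage `t`. -/
def firstSome {α : Type} (f : ℕ → Option α) : ℕ → Option α
  | 0 => none
  | t + 1 => firstSome f t <|> f t

section firstSome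

variable {α : Type} {f : ℕ → Option α}

theorem firstSome_mono {t t' : ℕ} {a : α} (h : t ≤ t') (ha : firstSome f t = some a) :
    firstSome f t' = some a := by
  induction h with
  | refl => exact ha
  | step _ ih => simp [firstSome, ih]

theorem exists_of_firstSome_eq_some {t : ℕ} {a : α} (ha : firstSome f t = some a) :
    ∃ j, f j = some a := by
  induction t with
  | zero => simp [firstSome] at ha
  | succ t ih =>
    cases h : firstSome f t with
    | none => exact ⟨t, by simpa [firstSome, h] using ha⟩
    | some b => exact ih (by simpa [firstSome, h] using ha)

theorem eq_none_of_forall_firstSome (h : ∀ t, firstSome f t = none) (t : ℕ) : f t = none := by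
  simpa [firstSome, h t] using h (t + 1)

theorem firstSome_eventually_const : ∃ T o, ∀ t ≥ T, firstSome f t = o := by
  by_cases h : ∀ t, firstSome f t = none
  · exact ⟨0, none, fun t _ => h t⟩
  · obtain ⟨T, hT⟩ := not_forall.1 h
    obtain ⟨a, ha⟩ := Option.ne_none_iff_exists'.1 hT
    exact ⟨T, some a, fun t ht => firstSome_mono ht ha⟩

theorem primrec_firstSome {β γ : Type} [Primcodable α] [Primcodable β] [Primcodable γ]
    {f : β → ℕ → Option α} {g : γ → β} {s : γ → ℕ} (hf : Primrec₂ f) (hg : Primrec g)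
    (hs : Primrec s) : Primrec fun c => firstSome (f (g c)) (s c) := by
  refine (Primrec.nat_rec' (h := fun c (z : ℕ × Option α) => z.2 <|> f (g c) z.1) hs (.const none)
    (Primrec.option_orElse.comp (Primrec.snd.comp .snd)
      (hf.comp (hg.comp .fst) (Primrec.fst.comp .snd))).to₂).of_eq fun c => ?_
  induction s c with
  | zero => rfl
  | succ t ih => simp only [firstSome, ← ih]

end firstSome

/-! ### The finite sets built against the programs. -/

open Nat.Partrec (Code)

/-- The first symbol that the `n`-th program, run for `t` steps, has written after reading `w`. -/
def answer (n : ℕ) (w : List ℕ) (t : ℕ) : Option ℕ :=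
  ((Code.evaln t (Denumerable.ofNat Code n) (Encodable.encode w)).bind
    (Encodable.decode (α := List ℕ))).bind List.head?

theorem primrec_answer {α : Type} [Primcodable α] {n t : α → ℕ} {w : α → List ℕ}
    (hn : Primrec n) (hw : Primrec w) (ht : Primrec t) :
    Primrec fun a => answer (n a) (w a) (t a) :=
  Primrec.option_bind (Primrec.option_bind
    (Code.primrec_evaln.comp ((ht.pair ((Primrec.ofNat Code).comp hn)).pair
      (Primrec.encode.comp hw))) (Primrec.decode.comp .snd).to₂) (Primrec.list_head?.comp .snd).to₂

theorem exists_answer_iff {h : List ℕ → List ℕ} (hh : Computable h) :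
    ∃ n, ∀ w m, (∃ t, answer n w t = some m) ↔ (h w).head? = some m := by
  obtain ⟨c, hc⟩ := Code.exists_code.1 hh
  have hc' : ∀ w, Code.eval c (Encodable.encode w) = Part.some (Encodable.encode (h w)) := by
    intro w
    rw [hc]
    simp
  refine ⟨Encodable.encode c, fun w m => ?_⟩
  constructor
  · rintro ⟨t, ht⟩
    simp only [answer, Denumerable.ofNat_encode, Option.bind_eq_some_iff] at ht
    obtain ⟨l, ⟨e, he, hl⟩, hm⟩ := ht
    have h1 := Code.evaln_sound he
    rw [hc', Part.mem_some_iff] at h1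
    rw [h1, Encodable.encodek] at hl
    rw [Option.some.inj hl, hm]
  · intro hm
    have h1 : Encodable.encode (h w) ∈ Code.eval c (Encodable.encode w) := by
      rw [hc']
      exact Part.mem_some _
    obtain ⟨t, ht⟩ := Code.evaln_complete.1 h1
    refine ⟨t, ?_⟩
    rw [answer, Denumerable.ofNat_encode, Option.mem_def.1 ht]
    simp [hm]

/-- The name of the point `(n, ℕ)` that lists the natural numbers in order. -/
def nameOfUniv (n i : ℕ) : ℕ := if i = 0 then n else i

/-- The name of the point `(n, {k})` that lists `k` again and again. -/
def nameOfSingleton (n k i : ℕ) : ℕ := if i = 0 then n else k + 1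

theorem primrec_initialWord {α : Type} [Primcodable α] {p : α → ℕ → ℕ} {s : α → ℕ}
    (hp : Primrec₂ p) (hs : Primrec s) : Primrec fun a => initialWord (p a) (s a) :=
  Primrec.list_map (Primrec.list_range.comp hs) hp

/-- The `j`-th attempt to find an answer of the `n`-th program on a prefix of the standard name
of `(n, ℕ)`; the result is the number of elements that were listed, with the answer. -/
def askUniv (n j : ℕ) : Option (ℕ × ℕ) :=
  (answer n (initialWord (nameOfUniv n) (j.unpair.1 + 1)) j.unpair.2).map fun m => (j.unpair.1, m)

/-- The `j`-th attempt to find an answer of the `n`-th program on a prefix of the standard name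
of `(n, {k})`. -/
def askSingleton (n k j : ℕ) : Option ℕ :=
  answer n (initialWord (nameOfSingleton n k) (j.unpair.1 + 1)) j.unpair.2

theorem primrec_askUniv : Primrec₂ askUniv := by
  have h1 : Primrec fun z : ℕ × ℕ => z.2.unpair.1 := Primrec.fst.comp (Primrec.unpair.comp .snd)
  have h2 : Primrec fun z : ℕ × ℕ => z.2.unpair.2 := Primrec.snd.comp (Primrec.unpair.comp .snd)
  have hw : Primrec fun z : ℕ × ℕ => initialWord (nameOfUniv z.1) (z.2.unpair.1 + 1) :=
    primrec_initialWord (p := fun z : ℕ × ℕ => nameOfUniv z.1)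
      (Primrec.ite (Primrec.eq.comp .snd (.const 0)) (Primrec.fst.comp .fst) .snd)
      (Primrec.succ.comp h1)
  exact Primrec.option_map (primrec_answer .fst hw h2) ((h1.comp .fst).pair .snd).to₂

theorem primrec_askSingleton : Primrec₂ fun z : ℕ × ℕ => askSingleton z.1 z.2 := by
  have h1 : Primrec fun z : (ℕ × ℕ) × ℕ => z.2.unpair.1 :=
    Primrec.fst.comp (Primrec.unpair.comp .snd)
  have h2 : Primrec fun z : (ℕ × ℕ) × ℕ => z.2.unpair.2 :=
    Primrec.snd.comp (Primrec.unpair.comp .snd)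
  have hw : Primrec fun z : (ℕ × ℕ) × ℕ =>
      initialWord (nameOfSingleton z.1.1 z.1.2) (z.2.unpair.1 + 1) :=
    primrec_initialWord (p := fun z : (ℕ × ℕ) × ℕ => nameOfSingleton z.1.1 z.1.2)
      (Primrec.ite (Primrec.eq.comp .snd (.const 0)) (Primrec.fst.comp (Primrec.fst.comp .fst))
        (Primrec.succ.comp (Primrec.snd.comp (Primrec.fst.comp .fst))))
      (Primrec.succ.comp h1)
  exact primrec_answer (Primrec.fst.comp .fst) hw h2

/-- The number `k` such that the `n`-th program has answered on the first `k` elements of `ℕ`. -/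
def pivot (n t : ℕ) : Option ℕ := (firstSome (askUniv n) t).map Prod.fst

/-- The approximation of the `n`-th finite set. It is empty until the `n`-th program answers `m`
on the list `0, …, k - 1`. Then it is `{k}`, and it grows to `{0, …, k}` if this program gives
another answer than `m` on the list `k, …, k`. -/
def approx (n t : ℕ) : List ℕ :=
  (firstSome (askUniv n) t).elim [] fun km =>
    (firstSome (askSingleton n km.1) t).elim [km.1] fun m =>
      if m = km.2 then [km.1] else List.range (km.1 + 1)

theorem primrec_pivot : Primrec₂ pivot :=
  Primrec.option_map (primrec_firstSome primrec_askUniv .fst .snd) (Primrec.fst.comp .snd).to₂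

theorem primrec_approx : Primrec₂ approx := by
  have hk : Primrec fun z : (ℕ × ℕ) × ℕ × ℕ => [z.2.1] :=
    Primrec.list_cons.comp (Primrec.fst.comp .snd) (.const [])
  have h1 : Primrec₂ fun (z : (ℕ × ℕ) × ℕ × ℕ) (m : ℕ) =>
      if m = z.2.2 then [z.2.1] else List.range (z.2.1 + 1) :=
    Primrec.ite (Primrec.eq.comp .snd (Primrec.snd.comp (Primrec.snd.comp .fst)))
      (hk.comp .fst) (Primrec.list_range.comp
        (Primrec.succ.comp (Primrec.fst.comp (Primrec.snd.comp .fst))))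
  have h2 : Primrec fun z : (ℕ × ℕ) × ℕ × ℕ => firstSome (askSingleton z.1.1 z.2.1) z.1.2 :=
    primrec_firstSome (f := fun z : ℕ × ℕ => askSingleton z.1 z.2) primrec_askSingleton
      ((Primrec.fst.comp .fst).pair (Primrec.fst.comp .snd)) (Primrec.snd.comp .fst)
  refine (Primrec.option_casesOn (primrec_firstSome primrec_askUniv .fst .snd) (.const [])
    (Primrec.option_casesOn h2 hk h1).to₂).of_eq fun z => ?_
  rw [approx]
  cases firstSome (askUniv z.1) z.2 with
  | none => rfl
  | some km =>
    dsimp only [Option.elim]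
    cases firstSome (askSingleton z.1 km.1) z.2 <;> rfl

theorem approx_eq_nil {n t : ℕ} (h : firstSome (askUniv n) t = none) : approx n t = [] := by
  simp [approx, h]

theorem approx_eq_singleton {n t k m : ℕ} (h : firstSome (askUniv n) t = some (k, m))
    (h' : ∀ m', firstSome (askSingleton n k) t = some m' → m' = m) : approx n t = [k] := by
  cases hs : firstSome (askSingleton n k) t with
  | none => simp [approx, h, hs]
  | some m' => simp [approx, h, hs, h' m' hs]

theorem approx_eq_range {n t k m m' : ℕ} (h : firstSome (askUniv n) t = some (k, m))
    (h' : firstSome (askSingleton n k) t = some m') (hm : m' ≠ m) :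
    approx n t = List.range (k + 1) := by
  simp [approx, h, h', hm]

theorem approx_of_pivot {n t k : ℕ} (h : pivot n t = some k) :
    approx n t = [k] ∨ approx n t = List.range (k + 1) := by
  obtain ⟨⟨k, m⟩, hkm, rfl⟩ := Option.map_eq_some_iff.1 h
  by_cases h' : ∃ m', firstSome (askSingleton n k) t = some m' ∧ m' ≠ m
  · obtain ⟨m', h1, h2⟩ := h'
    exact .inr (approx_eq_range hkm h1 h2)
  · refine .inl (approx_eq_singleton hkm fun m' h1 => ?_)
    by_contra h2
    exact h' ⟨m', h1, h2⟩

theorem pivot_mono {n t t' k : ℕ} (h : t ≤ t') (hk : pivot n t = some k) :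
    pivot n t' = some k := by
  obtain ⟨km, hkm, rfl⟩ := Option.map_eq_some_iff.1 hk
  simp [pivot, firstSome_mono h hkm]

/-- The pivot never changes once found, and the only later change is from `[k]` to `List.range (k +
1)`. This monotonicity makes the limit sets uniformly enumerable. -/
theorem approx_mono {n t t' j : ℕ} (h : t ≤ t') (hj : j ∈ approx n t) : j ∈ approx n t' := by
  cases hu : firstSome (askUniv n) t with
  | none => simp [approx_eq_nil hu] at hj
  | some km =>
    obtain ⟨k, m⟩ := km
    have hp : pivot n t = some k := by simp [pivot, hu]
    have hk : k ∈ approx n t' := by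
      rcases approx_of_pivot (pivot_mono h hp) with h1 | h1 <;> simp [h1]
    by_cases h' : ∃ m', firstSome (askSingleton n k) t = some m' ∧ m' ≠ m
    · obtain ⟨m', h1, h2⟩ := h'
      rw [approx_eq_range hu h1 h2] at hj
      rwa [approx_eq_range (firstSome_mono h hu) (firstSome_mono h h1) h2]
    · rw [approx_eq_singleton hu fun m' h1 => by
        by_contra h2
        exact h' ⟨m', h1, h2⟩, List.mem_singleton] at hj
      rwa [hj]

theorem approx_eventually_const (n : ℕ) : ∃ I, ∃ T, ∀ t ≥ T, approx n t = I := by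
  obtain ⟨T, o, hT⟩ := firstSome_eventually_const (f := askUniv n)
  cases o with
  | none => exact ⟨[], T, fun t ht => approx_eq_nil (hT t ht)⟩
  | some km =>
    obtain ⟨T', o', hT'⟩ := firstSome_eventually_const (f := askSingleton n km.1)
    refine ⟨o'.elim [km.1] fun m => if m = km.2 then [km.1] else List.range (km.1 + 1),
      max T T', fun t ht => ?_⟩
    simp [approx, hT t (le_of_max_le_left ht), hT' t (le_of_max_le_right ht)]

/-- The final value of the approximation of the `n`-th finite set. -/
noncomputable def limitList (n : ℕ) : List ℕ := (approx_eventually_const n).choose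

theorem approx_eventually_eq (n : ℕ) : ∃ T, ∀ t ≥ T, approx n t = limitList n :=
  (approx_eventually_const n).choose_spec

theorem limitList_eq {n T : ℕ} {I : List ℕ} (h : ∀ t ≥ T, approx n t = I) : limitList n = I := by
  obtain ⟨T', hT'⟩ := approx_eventually_eq n
  rw [← hT' (max T T') (le_max_right _ _), h _ (le_max_left _ _)]

theorem mem_limitList_iff {n j : ℕ} : j ∈ limitList n ↔ ∃ t, j ∈ approx n t := by
  obtain ⟨T, hT⟩ := approx_eventually_eq n
  constructor
  · intro hj
    exact ⟨T, by rwa [hT T le_rfl]⟩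
  · rintro ⟨t, ht⟩
    rw [← hT _ (le_max_right t T)]
    exact approx_mono (le_max_left _ _) ht

theorem limitList_of_pivot {n t k : ℕ} (h : pivot n t = some k) :
    limitList n = [k] ∨ limitList n = List.range (k + 1) := by
  obtain ⟨T, hT⟩ := approx_eventually_eq n
  rw [← hT _ (le_max_right t T)]
  exact approx_of_pivot (pivot_mono (le_max_left _ _) h)

theorem exists_pivot {n : ℕ} (h : limitList n ≠ []) : ∃ t k, pivot n t = some k := by
  by_contra! hc
  refine h (limitList_eq (T := 0) fun t _ => approx_eq_nil ?_)
  cases hu : firstSome (askUniv n) t with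
  | none => rfl
  | some km => exact absurd (by simp [pivot, hu]) (hc t km.1)

/-! ### The points of a family and their separation. -/

theorem listPair_nil : listPair [] = {Set.univ} := by
  ext x
  simp only [listPair, List.not_mem_nil, not_false_eq_true]
  constructor
  · rintro ⟨hx, rfl | rfl⟩
    · exact absurd hx Set.not_nonempty_empty
    · rfl
  · rintro rfl
    exact ⟨Set.univ_nonempty, .inr rfl⟩

theorem setOf_mem_mem_listPair {I : List ℕ} (hI : I ≠ []) : {j | j ∈ I} ∈ listPair I :=
  ⟨List.exists_mem_of_ne_nil I hI, .inl rfl⟩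

theorem setOf_notMem_mem_listPair (I : List ℕ) : {j | j ∉ I} ∈ listPair I := by
  obtain ⟨j, hj⟩ := Infinite.exists_notMem_finset I.toFinset
  exact ⟨⟨j, by simpa using hj⟩, .inr rfl⟩

theorem listPair_eq {I : List ℕ} (hI : I ≠ []) : listPair I = {{j | j ∈ I}, {j | j ∉ I}} := by
  ext x
  constructor
  · exact fun h => h.2
  · rintro (rfl | rfl)
    · exact setOf_mem_mem_listPair hI
    · exact setOf_notMem_mem_listPair I

theorem eq_iff_inter_nonempty_of_mem_listPair {I : List ℕ} {x y : Set ℕ} (hx : x ∈ listPair I)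
    (hy : y ∈ listPair I) : x = y ↔ (x ∩ y).Nonempty := by
  constructor
  · rintro rfl
    rw [Set.inter_self]
    exact hx.1
  · rintro ⟨a, hax, hay⟩
    rcases hx.2 with rfl | rfl <;> rcases hy.2 with rfl | rfl
    · rfl
    · exact absurd hax hay
    · exact absurd hay hax
    · rfl

/-- The pairs of numbers that separate the two points of the `n`-th set of the family. -/
def Separates (n t a b : ℕ) : Prop :=
  (pivot n t = some a ∧ a < b) ∨ (pivot n t = some b ∧ b < a)

theorem primrecPred_separates :
    PrimrecPred fun z : ((ℕ × ℕ) × ℕ) × ℕ => Separates z.1.1.1 z.1.1.2 z.1.2 z.2 := by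
  have hp : Primrec fun z : ((ℕ × ℕ) × ℕ) × ℕ => pivot z.1.1.1 z.1.1.2 :=
    primrec_pivot.comp (Primrec.fst.comp (Primrec.fst.comp .fst))
      (Primrec.snd.comp (Primrec.fst.comp .fst))
  have ha : Primrec fun z : ((ℕ × ℕ) × ℕ) × ℕ => z.1.2 := Primrec.snd.comp .fst
  exact PrimrecPred.or
    (PrimrecPred.and (Primrec.eq.comp hp (Primrec.option_some.comp ha))
      (Primrec.nat_lt.comp ha .snd))
    (PrimrecPred.and (Primrec.eq.comp hp (Primrec.option_some.comp .snd))
      (Primrec.nat_lt.comp .snd ha))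

/-- A pivot belongs to the limit set and bounds it, so no member contains both the pivot and a
larger number. Without a pivot the family has only one member. -/
theorem ne_iff_exists_separates {n : ℕ} {x y : Set ℕ} (hx : x ∈ listPair (limitList n))
    (hy : y ∈ listPair (limitList n)) :
    x ≠ y ↔ ∃ t, ∃ a ∈ x, ∃ b ∈ y, Separates n t a b := by
  have hpivot : ∀ {t k : ℕ}, pivot n t = some k →
      k ∈ limitList n ∧ ∀ b, k < b → b ∉ limitList n := by
    intro t k h
    rcases limitList_of_pivot h with h | h <;> rw [h]
    · exact ⟨by simp, fun b hb => by simpa using hb.ne'⟩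
    · exact ⟨by simp, fun b hb => by simpa using hb⟩
  constructor
  · intro hne
    have hnil : limitList n ≠ [] := by
      intro h
      rw [h, listPair_nil] at hx hy
      exact hne (hx.trans hy.symm)
    obtain ⟨t, k, hk⟩ := exists_pivot hnil
    have h1 : k ∈ {j | j ∈ limitList n} := (hpivot hk).1
    have h2 : k + 1 ∈ {j | j ∉ limitList n} := (hpivot hk).2 _ k.lt_succ_self
    rcases hx.2 with rfl | rfl <;> rcases hy.2 with rfl | rfl
    · exact absurd rfl hne
    · exact ⟨t, k, h1, k + 1, h2, .inl ⟨hk, k.lt_succ_self⟩⟩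
    · exact ⟨t, k + 1, h2, k, h1, .inr ⟨hk, k.lt_succ_self⟩⟩
    · exact absurd rfl hne
  · rintro ⟨t, a, ha, b, hb, h⟩ rfl
    have : ∃ k ∈ x, ∃ j ∈ x, pivot n t = some k ∧ k < j := by
      rcases h with h | h
      exacts [⟨a, ha, b, hb, h⟩, ⟨b, hb, a, ha, h⟩]
    obtain ⟨k, hk, j, hj, h, hkj⟩ := this
    rcases hx.2 with rfl | rfl
    · exact (hpivot h).2 j hkj hj
    · exact hk (hpivot h).1

/-! ### The diagonal argument and the conclusion. -/

open RepresentedSpace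

/-- The space that diagonalises against all computable injections into `ℕ`. -/
noncomputable abbrev diagonalSpace : RepresentedSpace :=
  familySpace fun n => listPair (limitList n)

theorem initialWord_congr {p q : ℕ → ℕ} {n : ℕ} (h : ∀ i < n, p i = q i) :
    initialWord p n = initialWord q n :=
  List.map_congr_left fun i hi => h i (List.mem_range.1 hi)

theorem enumeratedSet_nameOfUniv (n : ℕ) :
    enumeratedSet (fun k => nameOfUniv n (k + 1)) = Set.univ :=
  Set.eq_univ_of_forall fun a => ⟨a, by simp [nameOfUniv]⟩

theorem enumeratedSet_nameOfSingleton (n k : ℕ) :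
    enumeratedSet (fun i => nameOfSingleton n k (i + 1)) = {j | j ∈ [k]} := by
  refine Set.ext fun a => ⟨?_, ?_⟩
  · rintro ⟨i, hi⟩
    have : k = a := by simpa [nameOfSingleton] using hi
    simp [this]
  · intro h
    have : a = k := by simpa using h
    exact ⟨0, by simp [nameOfSingleton, this]⟩

theorem not_exists_computable_injection :
    ¬ ∃ f : diagonalSpace.Carrier → ℕ,
      Function.Injective f ∧ IsComputableMap diagonalSpace natSpace f := by
  rintro ⟨f, hf, R, ⟨h, hh, hmono, hRh⟩, hR⟩
  obtain ⟨n, hn⟩ := exists_answer_iff hh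
  have heval : ∀ {p : ℕ → ℕ} {x : Set ℕ} (hx : x ∈ listPair (limitList n)),
      p 0 = n → enumeratedSet (fun k => p (k + 1)) = x →
      (∃ N, ∀ j ≥ N, (h (initialWord p j)).head? = some (f ⟨n, x, hx⟩)) ∧
        ∀ j m, (h (initialWord p j)).head? = some m → m = f ⟨n, x, hx⟩ :=
    fun hx h0 hp => head_eq_of_mem_rep hR hmono hRh (mem_rep_familySpace.2 ⟨h0.symm, hp.symm⟩)
  -- No answer at all on the name of `(n, ℕ)`: then this is a point of the space, and the realiser
  -- must answer.
  by_cases hU : ∀ t, firstSome (askUniv n) t = none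
  · have hI : limitList n = [] := limitList_eq (T := 0) fun t _ => approx_eq_nil (hU t)
    have hx : Set.univ ∈ listPair (limitList n) := by
      rw [hI, listPair_nil]
      rfl
    obtain ⟨N, hN⟩ := (heval hx (p := nameOfUniv n) rfl (enumeratedSet_nameOfUniv n)).1
    obtain ⟨t, ht⟩ := (hn _ _).2 (hN (N + 1) N.le_succ)
    have h1 := eq_none_of_forall_firstSome hU (Nat.pair N t)
    simp [askUniv, ht] at h1
  obtain ⟨t, ht⟩ := not_forall.1 hU
  obtain ⟨⟨k, m⟩, hkm⟩ := Option.ne_none_iff_exists'.1 ht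
  have hm : (h (initialWord (nameOfUniv n) (k + 1))).head? = some m := by
    obtain ⟨j, hj⟩ := exists_of_firstSome_eq_some hkm
    obtain ⟨m', hm', he⟩ := Option.map_eq_some_iff.1 hj
    obtain ⟨rfl, rfl⟩ := Prod.mk.inj he
    exact (hn _ _).1 ⟨_, hm'⟩
  -- Likewise without an answer on `k, k, …`: the limit set is `{k}`, so the realiser must answer.
  by_cases hS : ∀ t, firstSome (askSingleton n k) t = none
  · have hI : limitList n = [k] := limitList_eq (T := t) fun t' ht' =>
      approx_eq_singleton (firstSome_mono ht' hkm) fun m' h' => by simp [hS t'] at h'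
    have hx : {j | j ∈ [k]} ∈ listPair (limitList n) := by
      rw [hI]
      exact setOf_mem_mem_listPair (by simp)
    obtain ⟨N, hN⟩ := (heval hx (p := nameOfSingleton n k) rfl
      (enumeratedSet_nameOfSingleton n k)).1
    obtain ⟨t, ht⟩ := (hn _ _).2 (hN (N + 1) N.le_succ)
    have h1 := eq_none_of_forall_firstSome hS (Nat.pair N t)
    simp [askSingleton, ht] at h1
  obtain ⟨t', ht'⟩ := not_forall.1 hS
  obtain ⟨m', hm'⟩ := Option.ne_none_iff_exists'.1 ht'
  obtain ⟨s, hs⟩ : ∃ s, (h (initialWord (nameOfSingleton n k) (s + 1))).head? = some m' := by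
    obtain ⟨j, hj⟩ := exists_of_firstSome_eq_some hm'
    exact ⟨_, (hn _ _).1 ⟨_, hj⟩⟩
  by_cases hmm : m' = m
  · subst hmm
    have hI : limitList n = [k] := limitList_eq (T := max t t') fun t'' h'' =>
      approx_eq_singleton (firstSome_mono (le_of_max_le_left h'') hkm) fun m₁ h₁ => by
        rw [firstSome_mono (le_of_max_le_right h'') hm'] at h₁
        exact (Option.some.inj h₁).symm
    have hx : {j | j ∈ [k]} ∈ listPair (limitList n) := by
      rw [hI]
      exact setOf_mem_mem_listPair (by simp)
    have hy : {j | j ∉ [k]} ∈ listPair (limitList n) := by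
      rw [hI]
      exact setOf_notMem_mem_listPair [k]
    -- The standard name of `(n, ℕ)` with the entry for `k` erased. That entry stands at position `k
    -- + 1`, just after the prefix that was answered, so the answer `m` is also the value at the
    -- complement of `{k}`.
    let q : ℕ → ℕ := fun i => if i = 0 then n else if i = k + 1 then 0 else i
    have hq : enumeratedSet (fun i => q (i + 1)) = {j | j ∉ [k]} := by
      refine Set.ext fun a => ⟨?_, ?_⟩
      · rintro ⟨i, hi⟩
        by_cases hik : i = k
        · simp [q, hik] at hi
        · have : i = a := by simpa [q, hik] using hi
          simpa [← this] using hik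
      · intro ha
        have : a ≠ k := by simpa using ha
        exact ⟨a, by simp [q, this]⟩
    have hqw : initialWord (nameOfUniv n) (k + 1) = initialWord q (k + 1) :=
      initialWord_congr fun i hi => by simp [nameOfUniv, q, hi.ne]
    have h1 := (heval hx (p := nameOfSingleton n k) rfl
      (enumeratedSet_nameOfSingleton n k)).2 _ _ hs
    have h2 := (heval hy (p := q) rfl hq).2 _ _ (hqw ▸ hm)
    have h3 := hf (h1.symm.trans h2)
    obtain ⟨-, h3⟩ := Sigma.mk.inj_iff.1 h3
    have h3 : ({j | j ∈ [k]} : Set ℕ) = {j | j ∉ [k]} := congrArg Subtype.val (eq_of_heq h3)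
    have h4 : k ∈ ({j | j ∉ [k]} : Set ℕ) := h3 ▸ List.mem_singleton_self k
    exact h4 (List.mem_singleton_self k)
  · have hI : limitList n = List.range (k + 1) := limitList_eq (T := max t t') fun t'' h'' =>
      approx_eq_range (firstSome_mono (le_of_max_le_left h'') hkm)
        (firstSome_mono (le_of_max_le_right h'') hm') hmm
    have hx : {j | j ∈ List.range (k + 1)} ∈ listPair (limitList n) := by
      rw [hI]
      exact setOf_mem_mem_listPair (by simp)
    -- Two names of `(n, {0, …, k})`: `q₁` extends the prefix `0, …, k - 1` and then repeats `k`;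
    -- `q₂` lists `k` in the first `s` places and then proceeds like `q₁`. The two answers must
    -- therefore agree.
    let q₁ : ℕ → ℕ := fun i => if i = 0 then n else min i (k + 1)
    let q₂ : ℕ → ℕ := fun i => if i = 0 then n else if i < s + 1 then k + 1 else min (i - s) (k + 1)
    have hq₁ : enumeratedSet (fun i => q₁ (i + 1)) = {j | j ∈ List.range (k + 1)} := by
      refine Set.ext fun a => ⟨?_, ?_⟩
      · rintro ⟨i, hi⟩
        simp only [q₁] at hi
        rw [if_neg i.succ_ne_zero] at hi
        exact List.mem_range.2 (by omega)
      · intro ha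
        have ha := List.mem_range.1 ha
        refine ⟨a, ?_⟩
        simp only [q₁]
        rw [if_neg a.succ_ne_zero]
        omega
    have hq₂ : enumeratedSet (fun i => q₂ (i + 1)) = {j | j ∈ List.range (k + 1)} := by
      refine Set.ext fun a => ⟨?_, ?_⟩
      · rintro ⟨i, hi⟩
        simp only [q₂] at hi
        rw [if_neg i.succ_ne_zero] at hi
        refine List.mem_range.2 ?_
        split_ifs at hi <;> omega
      · intro ha
        have ha := List.mem_range.1 ha
        refine ⟨s + a, ?_⟩
        simp only [q₂]
        rw [if_neg (by omega), if_neg (by omega)]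
        omega
    have hw₁ : initialWord (nameOfUniv n) (k + 1) = initialWord q₁ (k + 1) :=
      initialWord_congr fun i hi => by simp [nameOfUniv, q₁, hi.le]
    have hw₂ : initialWord (nameOfSingleton n k) (s + 1) = initialWord q₂ (s + 1) :=
      initialWord_congr fun i hi => by simp only [nameOfSingleton, q₂, if_pos hi]
    have h1 := (heval hx (p := q₁) rfl hq₁).2 _ _ (hw₁ ▸ hm)
    have h2 := (heval hx (p := q₂) rfl hq₂).2 _ _ (hw₂ ▸ hs)
    exact hmm (h2.trans h1.symm)

theorem mainTheorem4 :
    ∃ X : RepresentedSpace,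
      X.IsComputablyDiscrete ∧ X.IsComputablyHausdorff ∧ X.IsPrecomputablyQuasiPolish ∧
      (¬ ∃ f : X.Carrier → ℕ,
        Function.Injective f ∧ RepresentedSpace.IsComputableMap X RepresentedSpace.natSpace f) ∧
      ∃ (S : ℕ → Set (Set ℕ)) (A B : ℕ → Set ℕ),
        REPred (fun k : ℕ × ℕ => k.2 ∈ A k.1) ∧
        REPred (fun k : ℕ × ℕ => k.2 ∈ B k.1) ∧
        (∀ n : ℕ, S n = {Set.univ} ∨
          ((A n \ B n).Finite ∧ S n = {A n \ B n, Set.univ \ (A n \ B n)})) ∧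
        X = RepresentedSpace.sum
          (fun n : ℕ => RepresentedSpace.opensNat.subspace (S n)) := by
  -- The limit sets are themselves enumerable, so nothing has to be removed and the second sequence
  -- is empty.
  refine ⟨diagonalSpace,
    isComputablyDiscrete_familySpace fun n x hx y hy => eq_iff_inter_nonempty_of_mem_listPair hx hy,
    isComputablyHausdorff_familySpace primrecPred_separates ?_
      fun n x hx y hy => ne_iff_exists_separates hx hy,
    isPrecomputablyQuasiPolish_familySpace primrec_approx approx_eventually_eq,
    not_exists_computable_injection,
    fun n => listPair (limitList n), fun n => {j | j ∈ limitList n}, fun _ => ∅, ?_, ?_, ?_, rfl⟩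
  · rintro n t t' a b htt (⟨h, hab⟩ | ⟨h, hab⟩)
    exacts [.inl ⟨pivot_mono htt h, hab⟩, .inr ⟨pivot_mono htt h, hab⟩]
  · have h : PrimrecPred fun z : (ℕ × ℕ) × ℕ => z.1.2 ∈ approx z.1.1 z.2 :=
      PrimrecPred.mem_list (Primrec.snd.comp .fst) (primrec_approx.comp (Primrec.fst.comp .fst) .snd)
    exact (REPred.exists_of_primrecPred (p := fun (k : ℕ × ℕ) t => k.2 ∈ approx k.1 t) h).of_eq
      fun k => mem_limitList_iff.symm
  · have h : ComputablePred fun _ : ℕ × ℕ => False := ⟨inferInstance, Computable.const false⟩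
    exact h.to_re.of_eq fun _ => Iff.rfl
  · intro n
    beta_reduce
    by_cases hI : limitList n = []
    · left
      rw [hI, listPair_nil]
    · right
      rw [Set.sdiff_empty]
      refine ⟨List.finite_toSet _, ?_⟩
      rw [listPair_eq hI, ← Set.compl_eq_univ_sdiff]
      rfl
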